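/- **Setting.** Let $d\ge 2$ and $T\ge 0$, and let $\Theta_0,\dots,\Theta_T\in\mathbb R^{d\times d}$ be symmetric positive definite precision matrices with covariance matrices $\Sigma_t=\Theta_t^{-1}$. For every $t$ let $X_t^{(1)},\dots,X_t^{(N_t)}$ be i.i.d. $\mathcal N(0,\Sigma_t)$ random vectors (no relation between different times is required), and let $\widehat\Sigma_t=\frac1{N_t}\sum_{i}X_t^{(i)}X_t^{(i)\top}$. Let $\kappa_1,\kappa_3<\infty$, $\kappa_2>0$, $0\le q<1$, $\theta_{\min}>0$, $\Delta_{\min}>0$ be constants, let $s(q,d)$ be a real-valued function, and suppose that * (bounded norm) for every $t$: $\|\Theta_t\|_\infty\le\kappa_1$, $\inf_{\|w\|_\infty=1}\|\Sigma_t w\|_\infty\ge\kappa_2$ and $\|\Sigma_t\|_{\infty/\infty}\le\kappa_3$, where $\|\cdot\|_\infty$ of a matrix is the norm induced by the vector sup norm and $\|\cdot\|_{\infty/\infty}$ is the largest absolute value of an entry; * (weak sparsity) for every $t$: $\max_i\sum_{j=1}^d|[\Sigma_t]_{ij}|^q\le s(q,d)$, with $0^0=0$; * (gaps) every nonzero entry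 of every $\Theta_t$ has absolute value at least $\theta_{\min}$, and every nonzero entry of every $\Theta_t-\Theta_{t-1}$, $1\le t\le T$, has absolute value at least $\Delta_{\min}$. For a matrix $M$ let $[\mathtt{ST}_\nu(M)]_{ij}=M_{ij}-\mathrm{sign}(M_{ij})\min\{|M_{ij}|,\nu\}$ for $i\ne j$ and $[\mathtt{ST}_\nu(M)]_{ii}=M_{ii}$. For $0<\gamma<1$ and parameters $\nu_t,\lambda_t$, the estimates $\{\widehat\Theta_t\}_{t=0}^T$ are symmetric matrices whose upper-triangular parts (with the diagonal) $\theta_t\in\mathbb R^{d(d+1)/2}$ form any optimal solution of $$\min\ (1-\gamma)\sum_{t=0}^T\|\theta_t\|_0+\gamma\sum_{t=1}^T\|\theta_t-\theta_{t-1}\|_0\quad\text{s.t.}\quad \|\theta_t-\widetilde F^*(\widehat\Sigma_t)\|_{\infty}\le\lambda_t,\ t=0,\dots,T,$$ where $\widetilde F^*(\widehat\Sigma_t)$ is the upper-triangular part of $[\mathtt{ST}_{\nu_t}(\widehat\Sigma_t)]^{-1}$. Let $\mathcal S_t$ be the set of positions $(i,j)$, $i\le j$, with $[\Theta_t]_{ij}\neq0$,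 let $\mathrm{supp}(M)$ be the set of positions of nonzero entries of $M$, let $\zeta=\max\{\log_d(T+1),1\}$, and write $r_t=\sqrt{\tau\log d/N_t}$. **Theorem.** Let $\tau>\zeta+2$. Suppose that $N_t\ge C\,s(q,d)^{2/(1-q)}\,\tau\log d$, $a_\nu r_t\le\nu_t\le b_\nu r_t$ and $a_\lambda r_t\le\lambda_t\le b_\lambda r_t$ for all $t$. Here $a_\nu>0$ is a sufficiently large constant depending only on $\kappa_1,\kappa_2,\kappa_3$; $b_\nu\ge a_\nu$ is arbitrary; $a_\lambda>0$ is a sufficiently large constant depending only on $\kappa_1,\kappa_2,\kappa_3,a_\nu,b_\nu$; $b_\lambda\ge a_\lambda$ is arbitrary; and $C>0$ depends only on all of these, $q$, $\theta_{\min}$ and $\Delta_{\min}$. Then, with probability at least $1-4d^{-\tau+\zeta+2}$, all matrices $\mathtt{ST}_{\nu_t}(\widehat\Sigma_t)$ are invertible, the optimization problem has an optimal solution, and all estimates $\{\widehat\Theta_t\}$ given by optimal solutions satisfy * (sparsistency) $\mathrm{supp}(\widehat\Theta_t)=\mathrm{supp}(\Theta_t)$ for $0\le t\le T$, and $\mathrm{supp}(\widehat\Theta_t-\widehat\Theta_{t-1})=\mathrm{supp}(\Theta_t-\Theta_{t-1})$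 for $1\le t\le T$; * (estimation error) for $0\le t\le T$, $$\|\widehat\Theta_t-\Theta_t\|_{\infty/\infty}\le K\sqrt{\frac{\tau\log d}{N_t}},\qquad \|\widehat\Theta_t-\Theta_t\|_F\le K\sqrt{\frac{\tau|\mathcal S_t|\log d}{N_t}},$$ with a constant $K>0$ that depends only on $\kappa_1,\kappa_2,\kappa_3,a_\nu,b_\nu,a_\lambda,b_\lambda$. -/

import Mathlib

open MeasureTheory ProbabilityTheory

namespace TimeVaryingMRF

noncomputable section

/-! ### Matrix norms -/

/-- The norm of a matrix induced by the sup norm on vectors (maximal absolute row sum). -/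
def inducedInftyNorm {d : ℕ} (M : Matrix (Fin d) (Fin d) ℝ) : ℝ :=
  letI := Matrix.linftyOpNormedAddCommGroup (m := Fin d) (n := Fin d) (α := ℝ)
  ‖M‖

/-- The elementwise maximum norm of a matrix. -/
def maxEntryNorm {d : ℕ} (M : Matrix (Fin d) (Fin d) ℝ) : ℝ :=
  letI := Matrix.normedAddCommGroup (m := Fin d) (n := Fin d) (α := ℝ)
  ‖M‖

/-- The Frobenius norm of a matrix. -/
def frobeniusNorm {d : ℕ} (M : Matrix (Fin d) (Fin d) ℝ) : ℝ :=
  letI := Matrix.frobeniusNormedAddCommGroup (m := Fin d) (n := Fin d) (α := ℝ)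
  ‖M‖

/-! ### Vectorization and supports -/

/-- Indices of the upper-triangular part (with the diagonal) of a `d × d` matrix; there are
`d (d + 1) / 2` of them. -/
abbrev UpperIdx (d : ℕ) : Type := {p : Fin d × Fin d // p.1 ≤ p.2}

/-- Vectorization of the upper-triangular part of a matrix. -/
def vech {d : ℕ} (M : Matrix (Fin d) (Fin d) ℝ) : UpperIdx d → ℝ :=
  fun p => M p.1.1 p.1.2

/-- The set of positions of the nonzero entries of a matrix. -/
def supp {d : ℕ} (M : Matrix (Fin d) (Fin d) ℝ) : Set (Fin d × Fin d) :=
  {p | M p.1 p.2 ≠ 0}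

/-- The set of indices of the nonzero elements of the vectorization of a symmetric matrix. -/
def upperSupp {d : ℕ} (M : Matrix (Fin d) (Fin d) ℝ) : Finset (UpperIdx d) :=
  Finset.univ.filter (fun p => vech M p ≠ 0)

/-! ### The optimization problem

Here `hammingNorm v` is the number of nonzero elements of `v`, and the norm on `ι → ℝ` is the
sup norm. -/

/-- The objective
`(1 - γ) ∑_{t=0}^T ‖θ_t‖₀ + γ ∑_{t=1}^T ‖θ_t - θ_{t-1}‖₀`. -/
def objective {ι : Type*} [Fintype ι] {T : ℕ} (γ : ℝ) (θ : Fin (T + 1) → ι → ℝ) : ℝ :=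
  (1 - γ) * ∑ t : Fin (T + 1), (hammingNorm (θ t) : ℝ)
    + γ * ∑ t : Fin T, (hammingNorm (θ t.succ - θ t.castSucc) : ℝ)

/-- The constraints `‖θ_t - m_t‖_∞ ≤ lam_t` for all `t`, where `m_t` is the proxy of the
canonical parameter at time `t`. -/
def IsFeasible {ι : Type*} [Fintype ι] {T : ℕ} (lam : Fin (T + 1) → ℝ)
    (m θ : Fin (T + 1) → ι → ℝ) : Prop :=
  ∀ t, ‖θ t - m t‖ ≤ lam t

/-- `θ` is an optimal solution of the problem. -/
def IsOptimal {ι : Type*} [Fintype ι] {T : ℕ} (γ : ℝ) (lam : Fin (T + 1) → ℝ)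
    (m θ : Fin (T + 1) → ι → ℝ) : Prop :=
  IsFeasible lam m θ ∧ ∀ θ', IsFeasible lam m θ' → objective γ θ ≤ objective γ θ'

/-- `Θhat` is an estimate of the precision matrices: symmetric matrices whose vectorizations form
an optimal solution of the problem with the matrix proxies `B`. -/
def IsEstimate {d T : ℕ} (γ : ℝ) (lam : Fin (T + 1) → ℝ)
    (B Θhat : Fin (T + 1) → Matrix (Fin d) (Fin d) ℝ) : Prop :=
  (∀ t, (Θhat t).IsSymm) ∧ IsOptimal γ lam (fun t => vech (B t)) (fun t => vech (Θhat t))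

/-! ### The approximate backward mapping -/

/-- Soft-thresholding of the off-diagonal entries of a matrix. -/
def softThreshold {d : ℕ} (ν : ℝ) (M : Matrix (Fin d) (Fin d) ℝ) : Matrix (Fin d) (Fin d) ℝ :=
  Matrix.of fun i j =>
    if i = j then M i j else M i j - Real.sign (M i j) * min |M i j| ν

/-- The sample covariance matrix `(1 / n) ∑ᵢ xᵢ xᵢᵀ` (the mean being known to be zero). -/
def sampleCov {d n : ℕ} (x : Fin n → EuclideanSpace ℝ (Fin d)) : Matrix (Fin d) (Fin d) ℝ :=
  (1 / (n : ℝ)) • ∑ i, Matrix.vecMulVec (fun a => x i a) (fun a => x i a)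

/-! ### Assumptions on the model -/

/-- The bounded norm assumption on a precision matrix `Θ` and its covariance matrix `Θ⁻¹`. -/
def BoundedNorm {d : ℕ} (κ₁ κ₂ κ₃ : ℝ) (Θ : Matrix (Fin d) (Fin d) ℝ) : Prop :=
  inducedInftyNorm Θ ≤ κ₁ ∧
    (∀ w : Fin d → ℝ, ‖w‖ = 1 → κ₂ ≤ ‖Matrix.mulVec Θ⁻¹ w‖) ∧
    maxEntryNorm Θ⁻¹ ≤ κ₃

/-- `|x|^q` with the convention `0^0 = 0`, so that for `q = 0` it is the indicator of `x ≠ 0`. -/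
def absPow (q x : ℝ) : ℝ := if x = 0 then 0 else |x| ^ q

/-- Weak sparsity with exponent `q` and bound `s`:
every row satisfies `∑ⱼ |Sᵢⱼ|^q ≤ s`. -/
def WeaklySparse {d : ℕ} (q s : ℝ) (S : Matrix (Fin d) (Fin d) ℝ) : Prop :=
  ∀ i, ∑ j, absPow q (S i j) ≤ s

/-- All nonzero entries of `M` have absolute value at least `c`. -/
def EntryGap {d : ℕ} (c : ℝ) (M : Matrix (Fin d) (Fin d) ℝ) : Prop :=
  ∀ i j, M i j ≠ 0 → c ≤ |M i j|

/-- For every `t`, the `N t` samples `X t i` are independent with law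
`𝒩(0, (Θ t)⁻¹)`. No relation between samples at different times is imposed. -/
def IsGMRFSample {Ω : Type*} [MeasurableSpace Ω] {d T : ℕ} (μ : Measure Ω)
    (Θ : Fin (T + 1) → Matrix (Fin d) (Fin d) ℝ) (N : Fin (T + 1) → ℕ)
    (X : ∀ t, Fin (N t) → Ω → EuclideanSpace ℝ (Fin d)) : Prop :=
  ∀ t, (∀ i, HasLaw (X t i) (multivariateGaussian 0 (Θ t)⁻¹) μ) ∧ iIndepFun (X t) μ

/-! ### Rates -/

/-- The exponent `ζ = max {log_d (T + 1), 1}`. -/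
def zeta (d T : ℕ) : ℝ := max (Real.logb d ((T : ℝ) + 1)) 1

/-- The rate `√(τ log d / n)`. -/
def rate (τ : ℝ) (d n : ℕ) : ℝ := Real.sqrt (τ * Real.log d / n)

end

end TimeVaryingMRF

namespace TimeVaryingMRF

/-! ### Concentration of sample covariances -/

/-! Everything is deterministic on one event, where each sample covariance is entrywise within `3 *
V * rate` of the truth. A chi-square Chernoff bound, polarization and a union bound over times and
entries give its probability (`exists_event_abs_sampleCov_sub_le`).

On that event `ν t` dominates the deviation. Soft-thresholding then has entrywise error at most `2 *
ν`, while weak sparsity controls its row sums (`sum_abs_softThreshold_sub_le`). For large samples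
the row sums are at most `κ₂ / 2`, so the thresholded matrix inherits half of the lower bound of the
covariance on sup-norm vectors. It is therefore invertible, with inverse entrywise within `lam t` of
`Θ t` (`isUnit_and_abs_inv_sub_le`).

Hence the truth is feasible and every feasible point is within `2 * lam` of it. The gaps then
prevent a feasible point from vanishing where the truth, or an increment of it, does not. The truth
minimizes each term of the objective separately, and since both weights are positive every optimum
shares its supports (`isOptimal_and_support_of_minimal`). The error bounds follow from the distance
`2 * lam` and the common support. -/

theorem inv_one_sub_le_exp {x : ℝ} (hx : |x| ≤ 1 / 2) : (1 - x)⁻¹ ≤ Real.exp (x + x ^ 2) := by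
  obtain ⟨h1, h2⟩ := abs_le.1 hx
  have hpos : 0 < 1 - x := by linarith
  rw [inv_le_iff_one_le_mul₀ hpos]
  rcases le_or_gt 0 x with h | h
  · have := Real.quadratic_le_exp_of_nonneg (x := x + x ^ 2) (by positivity)
    have h3 : 1 ≤ (1 + (x + x ^ 2) + (x + x ^ 2) ^ 2 / 2) * (1 - x) := by
      have h4 : 0 ≤ x ^ 2 * (1 - x - x ^ 2 - x ^ 3) := by
        refine mul_nonneg (sq_nonneg _) ?_
        have h5 : x ^ 2 ≤ 1 / 4 := by nlinarith
        have h6 : x ^ 3 ≤ 1 / 8 := by nlinarith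
        linarith
      nlinarith
    nlinarith
  · have := Real.add_one_le_exp (x + x ^ 2)
    have h3 : 0 ≤ (-x) ^ 3 := by
      have : 0 ≤ -x := by linarith
      positivity
    nlinarith

theorem integral_exp_mul_sq_gaussianReal {u : ℝ} (hu : u < 1 / 2) :
    ∫ x, Real.exp (u * x ^ 2) ∂(gaussianReal 0 1) = √((1 - 2 * u)⁻¹) := by
  rw [integral_gaussianReal_eq_integral_smul (by norm_num)]
  have h : ∀ x : ℝ, gaussianPDFReal 0 1 x • Real.exp (u * x ^ 2)
      = (√(2 * Real.pi))⁻¹ * Real.exp (-(1 / 2 - u) * x ^ 2) := by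
    intro x
    rw [gaussianPDFReal, smul_eq_mul, mul_assoc, ← Real.exp_add]
    simp only [NNReal.coe_one, mul_one]
    congr 2
    ring
  simp_rw [h]
  rw [integral_const_mul, integral_gaussian, ← Real.sqrt_inv, ← Real.sqrt_mul (by positivity)]
  congr 1
  have : 1 - 2 * u ≠ 0 := by linarith
  have h2 : 1 / 2 - u ≠ 0 := by linarith
  have := Real.pi_ne_zero
  field_simp

variable {Ω : Type*} [MeasurableSpace Ω] {μ : Measure Ω}

/-- The mgf is explicitly `exp (-tv) / √(1 - 2tv)`; `inv_one_sub_le_exp` at `x = 2tv` makes it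
sub-Gaussian near zero. -/
theorem integrable_and_mgf_sq_sub_le {Y : Ω → ℝ} {v : NNReal} (hY : HasLaw Y (gaussianReal 0 v) μ)
    {t : ℝ} (ht : |t| * v ≤ 1 / 4) :
    Integrable (fun ω => Real.exp (t * (Y ω ^ 2 - v))) μ ∧
      mgf (fun ω => Y ω ^ 2 - v) μ t ≤ Real.exp (2 * t ^ 2 * v ^ 2) := by
  have habs : |2 * (t * v)| ≤ 1 / 2 := by
    rw [abs_mul, abs_mul, abs_of_nonneg v.coe_nonneg, abs_two]; linarith
  have hu : t * v < 1 / 2 := by linarith [(abs_le.1 habs).2]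
  have hpos : 0 < 1 - 2 * (t * v) := by linarith
  have hmap : (gaussianReal 0 1).map (fun x => √v * x) = gaussianReal 0 v := by
    rw [gaussianReal_map_const_mul]
    congr 1
    · simp
    · ext; simp [Real.sq_sqrt]
  have hmeas : Measurable fun y : ℝ => Real.exp (t * (y ^ 2 - v)) := by fun_prop
  have hval : mgf (fun ω => Y ω ^ 2 - v) μ t
      = Real.exp (-(t * v)) * √((1 - 2 * (t * v))⁻¹) := by
    have h1 := hY.integral_comp (f := fun y : ℝ => Real.exp (t * (y ^ 2 - v)))
      hmeas.aestronglyMeasurable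
    rw [mgf]
    refine h1.trans ?_
    rw [← hmap, integral_map (by fun_prop) hmeas.aestronglyMeasurable,
      ← integral_exp_mul_sq_gaussianReal hu, ← integral_const_mul]
    refine integral_congr_ae (.of_forall fun x => ?_)
    simp only
    rw [← Real.exp_add, mul_pow, Real.sq_sqrt v.coe_nonneg]
    congr 1
    ring
  constructor
  -- The Bochner integral of a non-integrable function is zero, so the positive value just computed
  -- gives integrability.
  · refine Integrable.of_integral_ne_zero ?_
    rw [mgf] at hval
    rw [hval]
    exact (mul_pos (Real.exp_pos _) (Real.sqrt_pos.2 (inv_pos.2 hpos))).ne'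
  · rw [hval]
    have h2 : √((1 - 2 * (t * v))⁻¹) ≤ Real.exp (t * v + 2 * (t * v) ^ 2) := by
      rw [Real.sqrt_le_left (Real.exp_pos _).le, ← Real.exp_nat_mul]
      refine (inv_one_sub_le_exp habs).trans_eq ?_
      congr 1
      push_cast
      ring
    calc _ ≤ Real.exp (-(t * v)) * Real.exp (t * v + 2 * (t * v) ^ 2) := by gcongr
      _ = _ := by rw [← Real.exp_add]; congr 1; ring

theorem measureReal_abs_sum_sq_sub_ge_le [IsProbabilityMeasure μ] {n : ℕ} {Y : Fin n → Ω → ℝ}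
    {v : NNReal} (hY : ∀ i, HasLaw (Y i) (gaussianReal 0 v) μ) (hind : iIndepFun Y μ)
    {V ε : ℝ} (hV : 0 < V) (hvV : v ≤ V) (hε : 0 ≤ ε) (hεV : ε ≤ V) :
    μ.real {ω | n * ε ≤ |∑ i, (Y i ω ^ 2 - v)|} ≤ 2 * Real.exp (-(n * ε ^ 2 / (8 * V ^ 2))) := by
  set Z : Fin n → Ω → ℝ := fun i ω => Y i ω ^ 2 - v with hZ
  have hZae : ∀ i, AEMeasurable (Z i) μ := fun i =>
    ((hY i).aemeasurable.pow_const 2).sub_const _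
  have hZind : iIndepFun Z μ := hind.comp (fun _ y => y ^ 2 - (v : ℝ)) (fun _ => by fun_prop)
  have hmgf : ∀ t : ℝ, |t| * v ≤ 1 / 4 → mgf (∑ i, Z i) μ t ≤ Real.exp (n * (2 * t ^ 2 * v ^ 2)) := by
    intro t ht
    rw [hZind.mgf_sum₀ hZae, Real.exp_nat_mul]
    calc ∏ i, mgf (Z i) μ t ≤ ∏ _i : Fin n, Real.exp (2 * t ^ 2 * v ^ 2) :=
          Finset.prod_le_prod (fun _ _ => mgf_nonneg)
            fun i _ => (integrable_and_mgf_sq_sub_le (hY i) ht).2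
      _ = _ := by simp
  have hint : ∀ t : ℝ, |t| * v ≤ 1 / 4 → Integrable (fun ω => Real.exp (t * (∑ i, Z i) ω)) μ :=
    fun t ht => by
      refine Integrable.of_integral_ne_zero (ne_of_gt ?_)
      change 0 < mgf (∑ i, Z i) μ t
      rw [hZind.mgf_sum₀ hZae]
      exact Finset.prod_pos fun i _ => mgf_pos (integrable_and_mgf_sq_sub_le (hY i) ht).1
  have hv2 : (v : ℝ) ^ 2 ≤ V ^ 2 := by gcongr
  -- Minimizer of the Chernoff exponent `-t ε + 2 t² V²`; `ε ≤ V` keeps it in the range where the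
  -- mgf bound holds.
  set t : ℝ := ε / (4 * V ^ 2) with htdef
  have ht0 : 0 ≤ t := by positivity
  have htv : |t| * v ≤ 1 / 4 := by
    rw [abs_of_nonneg ht0]
    calc t * v ≤ V / (4 * V ^ 2) * V := by rw [htdef]; gcongr
      _ = 1 / 4 := by field_simp
  have hexp : Real.exp (-t * (n * ε)) * Real.exp (n * (2 * t ^ 2 * v ^ 2))
      ≤ Real.exp (-(n * ε ^ 2 / (8 * V ^ 2))) := by
    rw [← Real.exp_add, Real.exp_le_exp]
    calc -t * (n * ε) + n * (2 * t ^ 2 * v ^ 2) ≤ -t * (n * ε) + n * (2 * t ^ 2 * V ^ 2) := by gcongr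
      _ = _ := by rw [htdef]; field_simp; ring
  have hup : μ.real {ω | n * ε ≤ (∑ i, Z i) ω} ≤ Real.exp (-(n * ε ^ 2 / (8 * V ^ 2))) :=
    (measure_ge_le_exp_mul_mgf _ ht0 (hint t htv)).trans
      ((mul_le_mul_of_nonneg_left (hmgf t htv) (Real.exp_pos _).le).trans hexp)
  have hlo : μ.real {ω | (∑ i, Z i) ω ≤ -(n * ε)} ≤ Real.exp (-(n * ε ^ 2 / (8 * V ^ 2))) := by
    have htv' : |-t| * v ≤ 1 / 4 := by rwa [abs_neg]
    refine (measure_le_le_exp_mul_mgf _ (neg_nonpos.2 ht0) (hint _ htv')).trans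
      ((mul_le_mul_of_nonneg_left (hmgf _ htv') (Real.exp_pos _).le).trans ?_)
    rw [neg_neg, neg_sq, mul_neg, ← neg_mul]
    exact hexp
  have hsub : {ω | n * ε ≤ |∑ i, (Y i ω ^ 2 - v)|}
      ⊆ {ω | n * ε ≤ (∑ i, Z i) ω} ∪ {ω | (∑ i, Z i) ω ≤ -(n * ε)} := by
    intro ω hω
    simp only [Set.mem_ofPred_eq, Set.mem_union, Finset.sum_apply, hZ] at hω ⊢
    rcases le_abs.1 hω with h | h
    · exact Or.inl h
    · exact Or.inr (by linarith)
  calc _ ≤ _ := measureReal_mono hsub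
    _ ≤ _ := measureReal_union_le _ _
    _ ≤ _ := by linarith

/-- The law of a linear functional of a centered Gaussian vector. -/
theorem hasLaw_inner_multivariateGaussian {d : ℕ} {S : Matrix (Fin d) (Fin d) ℝ}
    (hS : S.PosSemidef) {X : Ω → EuclideanSpace ℝ (Fin d)}
    (hX : HasLaw X (multivariateGaussian 0 S) μ) (a : EuclideanSpace ℝ (Fin d)) :
    HasLaw (fun ω => inner ℝ a (X ω))
      (gaussianReal 0 (dotProduct a (S.mulVec a)).toNNReal) μ := by
  refine HasLaw.fun_comp (Y := fun x => inner ℝ a x) ⟨by fun_prop, ?_⟩ hX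
  have hL : (fun x : EuclideanSpace ℝ (Fin d) => inner ℝ a x) = (innerSL ℝ a) := rfl
  rw [hL, IsGaussian.map_eq_gaussianReal, ContinuousLinearMap.integral_comp_id_comm]
  · congr 1
    · simp
    · rw [← covarianceBilin_multivariateGaussian (μ := 0) hS, ← hL,
        covarianceBilin_self IsGaussian.memLp_two_id]
  · exact IsGaussian.integrable_id

theorem sampleCov_apply {d n : ℕ} (x : Fin n → EuclideanSpace ℝ (Fin d)) (i j : Fin d) :
    sampleCov x i j = (1 / (n : ℝ)) * ∑ k, x k i * x k j := by
  simp [sampleCov, Matrix.sum_apply, Matrix.vecMulVec_apply]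

/-- Entrywise concentration of the sample covariance matrix of Gaussian vectors. -/
theorem measureReal_abs_sampleCov_sub_ge_le [IsProbabilityMeasure μ] {d n : ℕ} (hn : 0 < n)
    {S : Matrix (Fin d) (Fin d) ℝ} (hS : S.PosSemidef) {X : Fin n → Ω → EuclideanSpace ℝ (Fin d)}
    (hX : ∀ k, HasLaw (X k) (multivariateGaussian 0 S) μ) (hind : iIndepFun X μ)
    {V ε : ℝ} (hV : 0 < V) (hSV : ∀ i j, |S i j| ≤ V / 4) (hε : 0 ≤ ε) (hεV : ε ≤ V)
    (i j : Fin d) :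
    μ.real {ω | ε ≤ |sampleCov (fun k => X k ω) i j - S i j|}
      ≤ 4 * Real.exp (-(n * ε ^ 2 / (8 * V ^ 2))) := by
  have hsymm : S j i = S i j := by simpa using hS.1.apply i j
  -- Polarization: `4 xᵢ xⱼ = (xᵢ + xⱼ)² - (xᵢ - xⱼ)²`, so `c = 1` and `c = -1` suffice. The bound
  -- `V / 4` on the entries keeps both variances at most `V`.
  have key : ∀ c : ℝ, |c| = 1 → μ.real {ω | n * ε ≤ |∑ k, ((X k ω i + c * X k ω j) ^ 2
      - (S i i + 2 * c * S i j + S j j))|} ≤ 2 * Real.exp (-(n * ε ^ 2 / (8 * V ^ 2))) := by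
    intro c hc
    have hc2 : c * c = 1 := by rw [← abs_mul_abs_self, hc, one_mul]
    set a : EuclideanSpace ℝ (Fin d) := EuclideanSpace.single i 1 + c • EuclideanSpace.single j 1
    have ha : dotProduct (a : Fin d → ℝ) (S.mulVec a) = S i i + 2 * c * S i j + S j j := by
      have : (a : Fin d → ℝ) = Pi.single i 1 + c • Pi.single j 1 := by
        simp [a]
      rw [this]
      simp only [Matrix.mulVec_add, Matrix.mulVec_smul, Matrix.mulVec_single_one, dotProduct_add,
        add_dotProduct, smul_dotProduct, dotProduct_smul, single_one_dotProduct, smul_eq_mul,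
        Matrix.col_apply, hsymm]
      linear_combination S j j * hc2
    have ha0 : 0 ≤ S i i + 2 * c * S i j + S j j := by
      rw [← ha]; simpa using hS.dotProduct_mulVec_nonneg (a : Fin d → ℝ)
    have hin : ∀ k ω, inner ℝ a (X k ω) = X k ω i + c * X k ω j := by
      intro k ω
      simp [a, inner_add_left, inner_smul_left, EuclideanSpace.inner_single_left]
    have hlaw : ∀ k, HasLaw (fun ω => X k ω i + c * X k ω j)
        (gaussianReal 0 (S i i + 2 * c * S i j + S j j).toNNReal) μ := by
      intro k
      have := hasLaw_inner_multivariateGaussian hS (hX k) a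
      simpa only [ha, hin] using this
    have hind' : iIndepFun (fun k ω => X k ω i + c * X k ω j) μ :=
      hind.comp (fun _ x => x i + c * x j) (fun _ => by fun_prop)
    have hle : ((S i i + 2 * c * S i j + S j j).toNNReal : ℝ) ≤ V := by
      rw [Real.coe_toNNReal _ ha0]
      have h1 : c * S i j ≤ V / 4 := by
        refine (le_abs_self _).trans ?_
        rw [abs_mul, hc, one_mul]
        exact hSV i j
      linarith [le_of_abs_le (hSV i i), le_of_abs_le (hSV j j)]
    have := measureReal_abs_sum_sq_sub_ge_le hlaw hind' hV hle hε hεV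
    rwa [Real.coe_toNNReal _ ha0] at this
  have hsub : {ω | ε ≤ |sampleCov (fun k => X k ω) i j - S i j|}
      ⊆ {ω | n * ε ≤ |∑ k, ((X k ω i + 1 * X k ω j) ^ 2 - (S i i + 2 * 1 * S i j + S j j))|}
        ∪ {ω | n * ε ≤ |∑ k, ((X k ω i + (-1) * X k ω j) ^ 2
          - (S i i + 2 * (-1) * S i j + S j j))|} := by
    intro ω hω
    simp only [Set.mem_ofPred_eq, Set.mem_union] at hω ⊢
    by_contra! hcon
    obtain ⟨h1, h2⟩ := hcon
    have hn' : (0 : ℝ) < n := by exact_mod_cast hn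
    have hdiff : (∑ k, ((X k ω i + 1 * X k ω j) ^ 2 - (S i i + 2 * 1 * S i j + S j j)))
        - ∑ k, ((X k ω i + (-1) * X k ω j) ^ 2 - (S i i + 2 * (-1) * S i j + S j j))
        = 4 * (n * (sampleCov (fun k => X k ω) i j - S i j)) := by
      have : (n : ℝ) * (sampleCov (fun k => X k ω) i j - S i j)
          = ∑ k, (X k ω i * X k ω j - S i j) := by
        rw [sampleCov_apply, Finset.sum_sub_distrib]
        simp only [Finset.sum_const, Finset.card_univ, Fintype.card_fin, nsmul_eq_mul]
        field_simp
      rw [this, ← Finset.sum_sub_distrib, Finset.mul_sum]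
      exact Finset.sum_congr rfl fun k _ => by ring
    have h3 : 4 * (n * ε) ≤ |4 * (n * (sampleCov (fun k => X k ω) i j - S i j))| := by
      rw [abs_mul, abs_mul, abs_of_pos hn', abs_of_pos (by norm_num : (0 : ℝ) < 4)]
      gcongr
    rw [← hdiff] at h3
    have h4 : 0 ≤ n * ε := by positivity
    linarith [abs_sub (∑ k, ((X k ω i + 1 * X k ω j) ^ 2 - (S i i + 2 * 1 * S i j + S j j)))
      (∑ k, ((X k ω i + (-1) * X k ω j) ^ 2 - (S i i + 2 * (-1) * S i j + S j j)))]
  calc _ ≤ _ := measureReal_mono hsub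
    _ ≤ _ := measureReal_union_le _ _
    _ ≤ _ := add_le_add (key 1 (by simp)) (key (-1) (by simp))
    _ = _ := by ring

end TimeVaryingMRF

namespace TimeVaryingMRF

/-! ### Matrix norms -/

section Norms

variable {d : ℕ} {M : Matrix (Fin d) (Fin d) ℝ}

theorem maxEntryNorm_le_iff {r : ℝ} (hr : 0 ≤ r) : maxEntryNorm M ≤ r ↔ ∀ i j, |M i j| ≤ r :=
  Matrix.norm_le_iff hr

theorem abs_apply_le_maxEntryNorm (M : Matrix (Fin d) (Fin d) ℝ) (i j : Fin d) :
    |M i j| ≤ maxEntryNorm M :=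
  letI := Matrix.normedAddCommGroup (m := Fin d) (n := Fin d) (α := ℝ)
  Matrix.norm_entry_le_entrywise_sup_norm M

theorem sum_abs_row_le_inducedInftyNorm (M : Matrix (Fin d) (Fin d) ℝ) (i : Fin d) :
    ∑ j, |M i j| ≤ inducedInftyNorm M := by
  rw [inducedInftyNorm, Matrix.linfty_opNorm_def]
  have := Finset.le_sup (f := fun i : Fin d => ∑ j, ‖M i j‖₊) (Finset.mem_univ i)
  simpa using NNReal.coe_le_coe.2 this

theorem frobeniusNorm_eq_sqrt (M : Matrix (Fin d) (Fin d) ℝ) :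
    frobeniusNorm M = √(∑ p : Fin d × Fin d, M p.1 p.2 ^ 2) := by
  rw [frobeniusNorm, Matrix.frobenius_norm_def, Real.sqrt_eq_rpow, Fintype.sum_prod_type]
  simp

end Norms

/-! ### Soft-thresholding -/

/-- If `|x| ≤ ν` the thresholded value is zero and `|y| ≤ 2ν`. Otherwise `x` shrinks by `ν` to a
point between `0` and `y`, so the error is at most `|y|`, and at most `ν + ν` by the triangle
inequality. -/
theorem abs_soft_threshold_sub_le {x y ν : ℝ} (hxy : |x - y| ≤ ν) :
    |x - Real.sign x * min |x| ν - y| ≤ min |y| (2 * ν) := by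
  obtain ⟨h1, h2⟩ := abs_le.1 hxy
  have hν : 0 ≤ ν := (abs_nonneg _).trans hxy
  rcases le_total |x| ν with h | h
  · have hx : Real.sign x * |x| = x := by
      rcases lt_trichotomy x 0 with hx | rfl | hx
      · rw [Real.sign_of_neg hx, abs_of_neg hx]; ring
      · simp
      · rw [Real.sign_of_pos hx, abs_of_pos hx, one_mul]
    rw [min_eq_left h, hx, sub_self, zero_sub, abs_neg, le_min_iff]
    refine ⟨le_rfl, ?_⟩
    have := abs_le.1 h
    exact abs_le.2 ⟨by linarith, by linarith⟩
  · rw [min_eq_right h, le_min_iff]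
    rcases lt_trichotomy x 0 with hx | hx | hx
    · rw [Real.sign_of_neg hx]
      rw [abs_of_neg hx] at h
      rw [abs_of_nonpos (by linarith : y ≤ 0), abs_le, abs_le]
      refine ⟨⟨?_, ?_⟩, ?_, ?_⟩ <;> linarith
    · subst hx
      rw [abs_zero] at h
      have : ν = 0 := le_antisymm h hν
      subst this
      have : y = 0 := by linarith
      simp [this]
    · rw [Real.sign_of_pos hx]
      rw [abs_of_pos hx] at h
      rw [abs_of_nonneg (by linarith : 0 ≤ y), abs_le, abs_le]
      refine ⟨⟨?_, ?_⟩, ?_, ?_⟩ <;> linarith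

/-- Split the minimum `m` as `m ^ q * m ^ (1 - q)` and bound each factor by a different argument.
This turns weak sparsity into a bound on row sums. -/
theorem min_abs_le_absPow_mul {q y c : ℝ} (hq0 : 0 ≤ q) (hq1 : q < 1) (hc : 0 ≤ c) :
    min |y| c ≤ absPow q y * c ^ (1 - q) := by
  unfold absPow
  split_ifs with hy
  · simp [hy, hc]
  · have hy' : 0 < |y| := abs_pos.2 hy
    rcases hc.eq_or_lt with rfl | hc
    · rw [Real.zero_rpow (by linarith)]; simp
    have hm : 0 < min |y| c := lt_min hy' hc
    calc min |y| c = min |y| c ^ q * min |y| c ^ (1 - q) := by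
          rw [← Real.rpow_add hm]; simp
      _ ≤ |y| ^ q * c ^ (1 - q) := by
          have := min_le_left |y| c
          have := min_le_right |y| c
          gcongr

section SoftThreshold

variable {d : ℕ} {S Shat : Matrix (Fin d) (Fin d) ℝ} {ν : ℝ}

theorem abs_softThreshold_sub_le (h : ∀ i j, |Shat i j - S i j| ≤ ν) (i j : Fin d) :
    |softThreshold ν Shat i j - S i j| ≤ 2 * ν := by
  have hν : 0 ≤ ν := (abs_nonneg _).trans (h i j)
  by_cases hij : i = j
  · simp only [softThreshold, Matrix.of_apply, hij, if_true]
    linarith [h j j]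
  · simp only [softThreshold, Matrix.of_apply, hij, if_false]
    exact (abs_soft_threshold_sub_le (h i j)).trans (min_le_right _ _)

/-- The unthresholded diagonal contributes `ν`; off the diagonal the error is at most `min |Sᵢⱼ|
(2ν)`, which weak sparsity sums without a factor `d`. -/
theorem sum_abs_softThreshold_sub_le {q s : ℝ} (hq0 : 0 ≤ q) (hq1 : q < 1)
    (hS : WeaklySparse q s S) (h : ∀ i j, |Shat i j - S i j| ≤ ν) (i : Fin d) :
    ∑ j, |softThreshold ν Shat i j - S i j| ≤ ν + s * (2 * ν) ^ (1 - q) := by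
  have hν : 0 ≤ ν := (abs_nonneg _).trans (h i i)
  have hpow : 0 ≤ (2 * ν) ^ (1 - q) := by positivity
  have habs : ∀ x, 0 ≤ absPow q x := fun x => by unfold absPow; split_ifs <;> positivity
  have hterm : ∀ j, |softThreshold ν Shat i j - S i j|
      ≤ (if i = j then ν else 0) + absPow q (S i j) * (2 * ν) ^ (1 - q) := by
    intro j
    by_cases hij : i = j
    · simp only [softThreshold, Matrix.of_apply, hij, if_true]
      have := mul_nonneg (habs (S j j)) hpow
      linarith [h j j]
    · simp only [softThreshold, Matrix.of_apply, hij, if_false, zero_add]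
      exact (abs_soft_threshold_sub_le (h i j)).trans
        (min_abs_le_absPow_mul hq0 hq1 (by linarith))
  calc _ ≤ ∑ j, ((if i = j then ν else 0) + absPow q (S i j) * (2 * ν) ^ (1 - q)) :=
        Finset.sum_le_sum fun j _ => hterm j
    _ = ν + (∑ j, absPow q (S i j)) * (2 * ν) ^ (1 - q) := by
        rw [Finset.sum_add_distrib, Finset.sum_mul]; simp
    _ ≤ _ := by gcongr; exact hS i

end SoftThreshold

/-! ### Perturbation of the inverse -/

theorem norm_mulVec_le_of_row_sum_le {d : ℕ} {D : Matrix (Fin d) (Fin d) ℝ} {ε : ℝ} (hε : 0 ≤ ε)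
    (hD : ∀ i, ∑ j, |D i j| ≤ ε) (w : Fin d → ℝ) : ‖D.mulVec w‖ ≤ ε * ‖w‖ := by
  rw [pi_norm_le_iff_of_nonneg (by positivity)]
  intro i
  calc ‖D.mulVec w i‖ ≤ ∑ j, ‖D i j * w j‖ := norm_sum_le Finset.univ fun j => D i j * w j
    _ ≤ ∑ j, |D i j| * ‖w‖ := Finset.sum_le_sum fun j _ => by
        rw [norm_mul]; exact mul_le_mul_of_nonneg_left (norm_le_pi_norm w j) (abs_nonneg _)
    _ = (∑ j, |D i j|) * ‖w‖ := by rw [Finset.sum_mul]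
    _ ≤ ε * ‖w‖ := by gcongr; exact hD i

/-- A matrix that is close to `Θ⁻¹` is invertible, and its inverse is entrywise close to `Θ`. -/
theorem isUnit_and_abs_inv_sub_le {d : ℕ} {κ₁ κ₂ κ₃ δ : ℝ} {Θ A : Matrix (Fin d) (Fin d) ℝ}
    (hκ₂ : 0 < κ₂) (hΘ : Θ.PosDef) (hb : BoundedNorm κ₁ κ₂ κ₃ Θ)
    (hrow : ∀ i, ∑ j, |A i j - Θ⁻¹ i j| ≤ κ₂ / 2) (hδ : ∀ i j, |A i j - Θ⁻¹ i j| ≤ δ) :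
    IsUnit A ∧ ∀ i j, |A⁻¹ i j - Θ i j| ≤ 2 / κ₂ * (δ * κ₁) := by
  obtain ⟨hb1, hb2, -⟩ := hb
  have hlow : ∀ w, κ₂ * ‖w‖ ≤ ‖Θ⁻¹.mulVec w‖ := by
    intro w
    rcases eq_or_ne w 0 with rfl | hw
    · simp
    · have hw' : 0 < ‖w‖ := norm_pos_iff.2 hw
      have := hb2 (‖w‖⁻¹ • w) (by rw [norm_smul, norm_inv, norm_norm, inv_mul_cancel₀ hw'.ne'])
      rw [Matrix.mulVec_smul, norm_smul, norm_inv, norm_norm, inv_mul_eq_div,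
        le_div_iff₀ hw'] at this
      exact this
  have hA : ∀ w, κ₂ / 2 * ‖w‖ ≤ ‖A.mulVec w‖ := by
    intro w
    have h1 := norm_mulVec_le_of_row_sum_le (D := A - Θ⁻¹) (by linarith) hrow w
    rw [Matrix.sub_mulVec] at h1
    have h2 := norm_sub_norm_le (Θ⁻¹.mulVec w) (A.mulVec w)
    rw [norm_sub_rev] at h2
    linarith [hlow w]
  have hinj : Function.Injective A.mulVec := by
    intro x y hxy
    have h1 := hA (x - y)
    rw [Matrix.mulVec_sub, sub_eq_zero.2 hxy, norm_zero] at h1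
    have h2 : ‖x - y‖ ≤ 0 := by
      by_contra! h
      have : 0 < κ₂ / 2 * ‖x - y‖ := by positivity
      linarith
    exact sub_eq_zero.1 (norm_le_zero_iff.1 h2)
  have hunit : IsUnit A := Matrix.mulVec_injective_iff_isUnit.1 hinj
  refine ⟨hunit, fun i j => ?_⟩
  have hdetA : IsUnit A.det := (Matrix.isUnit_iff_isUnit_det A).1 hunit
  have hdetΘ : IsUnit Θ.det := (Matrix.isUnit_iff_isUnit_det Θ).1 hΘ.isUnit
  have hδ0 : 0 ≤ δ := (abs_nonneg _).trans (hδ i j)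
  -- Read column by column, the lower bound on `A` reduces the inverse error to the right-hand side,
  -- where only the entrywise error `δ` and the row sums of the symmetric `Θ` matter.
  have hid : A * (A⁻¹ - Θ) = (Θ⁻¹ - A) * Θ := by
    rw [Matrix.mul_sub, Matrix.sub_mul, Matrix.mul_nonsing_inv _ hdetA,
      Matrix.nonsing_inv_mul _ hdetΘ]
  have hκ₁ : 0 ≤ κ₁ :=
    (Finset.sum_nonneg fun j _ => abs_nonneg (Θ i j)).trans
      ((sum_abs_row_le_inducedInftyNorm Θ i).trans hb1)
  have hsymm : ∀ a b, Θ a b = Θ b a := fun a b => by simpa using (hΘ.1.apply a b).symm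
  have hcol : ‖A.mulVec fun k => (A⁻¹ - Θ) k j‖ ≤ δ * κ₁ := by
    rw [pi_norm_le_iff_of_nonneg (by positivity)]
    intro k
    have : A.mulVec (fun k => (A⁻¹ - Θ) k j) k = ((Θ⁻¹ - A) * Θ) k j := by
      rw [← hid]; rfl
    rw [this, Matrix.mul_apply]
    calc _ ≤ ∑ l, ‖(Θ⁻¹ - A) k l * Θ l j‖ := norm_sum_le _ _
      _ ≤ ∑ l, δ * |Θ j l| := Finset.sum_le_sum fun l _ => by
          rw [norm_mul, hsymm l j]
          refine mul_le_mul_of_nonneg_right ?_ (abs_nonneg _)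
          rw [Matrix.sub_apply, Real.norm_eq_abs, abs_sub_comm]
          exact hδ k l
      _ = δ * ∑ l, |Θ j l| := by rw [Finset.mul_sum]
      _ ≤ _ := by gcongr; exact (sum_abs_row_le_inducedInftyNorm Θ j).trans hb1
  have h3 := (hA fun k => (A⁻¹ - Θ) k j).trans hcol
  have h4 : |(A⁻¹ - Θ) i j| ≤ ‖fun k => (A⁻¹ - Θ) k j‖ :=
    norm_le_pi_norm (fun k => (A⁻¹ - Θ) k j) i
  rw [Matrix.sub_apply] at h4
  refine h4.trans ?_
  rw [div_mul_eq_mul_div, le_div_iff₀ hκ₂]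
  linarith

/-! ### A lower bound on the sparsity level -/

/-- A diagonal entry of `Θ * Θ⁻¹ = 1` forces some entry of the row of `Θ⁻¹` to be at least `κ₁⁻¹`.
Bounding `s` away from zero is what lets the sample size condition make the rate small. -/
theorem min_one_inv_le_of_weaklySparse {d : ℕ} {κ₁ q s : ℝ} {Θ : Matrix (Fin d) (Fin d) ℝ}
    (i : Fin d) (hκ₁ : 0 < κ₁) (hΘ : Θ.PosDef) (hb : inducedInftyNorm Θ ≤ κ₁)
    (hq0 : 0 ≤ q) (hq1 : q < 1) (hs : WeaklySparse q s Θ⁻¹) : min 1 κ₁⁻¹ ≤ s := by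
  have hdet : IsUnit Θ.det := (Matrix.isUnit_iff_isUnit_det Θ).1 hΘ.isUnit
  have hone : ∑ j, Θ i j * Θ⁻¹ j i = 1 := by
    rw [← Matrix.mul_apply, Matrix.mul_nonsing_inv _ hdet, Matrix.one_apply_eq]
  have hsymm : ∀ a b, Θ⁻¹ a b = Θ⁻¹ b a := fun a b => by
    simpa using (hΘ.inv.1.apply a b).symm
  obtain ⟨j, hj⟩ : ∃ j, κ₁⁻¹ ≤ |Θ⁻¹ i j| := by
    by_contra! hcon
    have h1 : ∑ j, |Θ i j| ≤ κ₁ := (sum_abs_row_le_inducedInftyNorm Θ i).trans hb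
    have h2 : (1 : ℝ) < ∑ j, |Θ i j| * κ₁⁻¹ := by
      rw [← hone]
      refine Finset.sum_lt_sum (fun j _ => ?_) ?_
      · refine (le_abs_self _).trans ?_
        rw [abs_mul, hsymm j i]
        gcongr
        exact (hcon j).le
      -- Strictness needs one index with `Θ i j ≠ 0`; it exists because the sum is `1`.
      · obtain ⟨j, -, hj⟩ : ∃ j ∈ Finset.univ, Θ i j * Θ⁻¹ j i ≠ 0 :=
          Finset.exists_ne_zero_of_sum_ne_zero (by rw [hone]; norm_num)
        refine ⟨j, Finset.mem_univ _, (le_abs_self _).trans_lt ?_⟩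
        rw [abs_mul, hsymm j i]
        have : 0 < |Θ i j| := abs_pos.2 (left_ne_zero_of_mul hj)
        gcongr
        exact hcon j
    rw [← Finset.sum_mul, ← div_eq_mul_inv, lt_div_iff₀ hκ₁] at h2
    linarith
  have hpos : 0 < κ₁⁻¹ := inv_pos.2 hκ₁
  have habs : ∀ x, 0 ≤ absPow q x := fun x => by unfold absPow; split_ifs <;> positivity
  have hm : 0 < min 1 κ₁⁻¹ := lt_min one_pos hpos
  calc min 1 κ₁⁻¹ = min 1 κ₁⁻¹ ^ (1 : ℝ) := (Real.rpow_one _).symm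
    -- Lowering the exponent to `q` increases the power only for a base at most `1`, hence the
    -- minimum with `1`.
    _ ≤ min 1 κ₁⁻¹ ^ q := Real.rpow_le_rpow_of_exponent_ge hm (min_le_left _ _) hq1.le
    _ ≤ |Θ⁻¹ i j| ^ q := by gcongr; exact (min_le_right _ _).trans hj
    _ = absPow q (Θ⁻¹ i j) := by
        rw [absPow, if_neg]
        intro h
        rw [h, abs_zero] at hj
        linarith
    _ ≤ ∑ j, absPow q (Θ⁻¹ i j) :=
        Finset.single_le_sum (f := fun j => absPow q (Θ⁻¹ i j)) (fun j _ => habs _)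
          (Finset.mem_univ j)
    _ ≤ s := hs i

/-! ### Optimal solutions -/

section Optimal

variable {ι : Type*} [Fintype ι]

theorem hammingNorm_le_of_support {x y : ι → ℝ} (h : ∀ k, x k ≠ 0 → y k ≠ 0) :
    hammingNorm x ≤ hammingNorm y :=
  Finset.card_le_card fun k hk => by simp only [Finset.mem_filter_univ] at hk ⊢; exact h k hk

theorem support_of_hammingNorm_le {x y : ι → ℝ} (h : ∀ k, x k ≠ 0 → y k ≠ 0)
    (hxy : hammingNorm y ≤ hammingNorm x) (k : ι) (hk : y k ≠ 0) : x k ≠ 0 := by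
  have hsub : (Finset.univ.filter fun k => x k ≠ 0) ⊆ Finset.univ.filter fun k => y k ≠ 0 :=
    fun k hk => by simp only [Finset.mem_filter_univ] at hk ⊢; exact h k hk
  have := Finset.eq_of_subset_of_card_le hsub hxy
  have hk' : k ∈ Finset.univ.filter fun k => y k ≠ 0 := by simpa using hk
  rw [← this] at hk'
  simpa using hk'

variable {T : ℕ} {γ : ℝ} {lam : Fin (T + 1) → ℝ} {m θ : Fin (T + 1) → ι → ℝ}

/-- If the supports of a feasible point and of its increments are contained in those of every
feasible point, then it is optimal, and every optimal solution has the same supports. -/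
theorem isOptimal_and_support_of_minimal (hγ0 : 0 < γ) (hγ1 : γ < 1) (hθ : IsFeasible lam m θ)
    (hsupp : ∀ θ', IsFeasible lam m θ' → ∀ t k, θ t k ≠ 0 → θ' t k ≠ 0)
    (hdiff : ∀ θ', IsFeasible lam m θ' → ∀ (t : Fin T) k,
      (θ t.succ - θ t.castSucc) k ≠ 0 → (θ' t.succ - θ' t.castSucc) k ≠ 0) :
    IsOptimal γ lam m θ ∧ ∀ θ', IsOptimal γ lam m θ' →
      (∀ t k, θ' t k ≠ 0 ↔ θ t k ≠ 0) ∧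
      ∀ (t : Fin T) k, (θ' t.succ - θ' t.castSucc) k ≠ 0 ↔ (θ t.succ - θ t.castSucc) k ≠ 0 := by
  have hle1 : ∀ θ', IsFeasible lam m θ' → ∀ t, (hammingNorm (θ t) : ℝ) ≤ hammingNorm (θ' t) :=
    fun θ' h t => by exact_mod_cast hammingNorm_le_of_support (hsupp θ' h t)
  have hle2 : ∀ θ', IsFeasible lam m θ' → ∀ t : Fin T,
      (hammingNorm (θ t.succ - θ t.castSucc) : ℝ) ≤ hammingNorm (θ' t.succ - θ' t.castSucc) :=
    fun θ' h t => by exact_mod_cast hammingNorm_le_of_support (hdiff θ' h t)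
  have hγ1' : 0 < 1 - γ := by linarith
  refine ⟨⟨hθ, fun θ' h => ?_⟩, fun θ' h => ?_⟩
  · unfold objective
    gcongr with t _ t _
    · exact_mod_cast hle1 θ' h t
    · exact_mod_cast hle2 θ' h t
  · have hobj := h.2 θ hθ
    unfold objective at hobj
    have h1 := Finset.sum_le_sum fun t (_ : t ∈ Finset.univ) => hle1 θ' h.1 t
    have h2 := Finset.sum_le_sum fun t (_ : t ∈ Finset.univ) => hle2 θ' h.1 t
    have e1 := mul_le_mul_of_nonneg_left h1 hγ1'.le
    have e2 := mul_le_mul_of_nonneg_left h2 hγ0.le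
    -- Neither sum can exceed its minimum without the weighted total doing so; equality of the sums
    -- passes to each term, and nested supports of equal size coincide.
    have f1 := le_antisymm h1 (le_of_mul_le_mul_left (by linarith) hγ1')
    have f2 := le_antisymm h2 (le_of_mul_le_mul_left (by linarith) hγ0)
    rw [Finset.sum_eq_sum_iff_of_le fun t _ => hle1 θ' h.1 t] at f1
    rw [Finset.sum_eq_sum_iff_of_le fun t _ => hle2 θ' h.1 t] at f2
    refine ⟨fun t k => ⟨fun hk => ?_, hsupp θ' h.1 t k⟩,
      fun t k => ⟨fun hk => ?_, hdiff θ' h.1 t k⟩⟩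
    · exact support_of_hammingNorm_le (hsupp θ' h.1 t)
        (by exact_mod_cast (f1 t (Finset.mem_univ _)).ge) k hk
    · exact support_of_hammingNorm_le (hdiff θ' h.1 t)
        (by exact_mod_cast (f2 t (Finset.mem_univ _)).ge) k hk

end Optimal

/-! ### Estimates -/

section Estimates

variable {d : ℕ}

theorem IsSymm.apply_eq_vech {M : Matrix (Fin d) (Fin d) ℝ} (hM : M.IsSymm) (i j : Fin d) :
    M i j = vech M ⟨(min i j, max i j), min_le_max⟩ := by
  rcases le_total i j with h | h
  · simp [vech, h]
  · simp [vech, h, hM.apply i j]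

theorem supp_eq_of_vech {M M' : Matrix (Fin d) (Fin d) ℝ} (hM : M.IsSymm) (hM' : M'.IsSymm)
    (h : ∀ k, vech M k ≠ 0 ↔ vech M' k ≠ 0) : supp M = supp M' := by
  ext ⟨i, j⟩
  simp only [supp, Set.mem_ofPred_eq]
  rw [IsSymm.apply_eq_vech hM, IsSymm.apply_eq_vech hM']
  exact h _

/-- The number of nonzero entries of a symmetric matrix is at most twice that of its
upper-triangular part. -/
theorem card_filter_ne_zero_le {M : Matrix (Fin d) (Fin d) ℝ} (hM : M.IsSymm) :
    (Finset.univ.filter fun p : Fin d × Fin d => M p.1 p.2 ≠ 0).card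
      ≤ 2 * (upperSupp M).card := by
  have hsub : (Finset.univ.filter fun p : Fin d × Fin d => M p.1 p.2 ≠ 0)
      ⊆ (upperSupp M).image (fun p => p.1) ∪ (upperSupp M).image (fun p => p.1.swap) := by
    rintro ⟨i, j⟩ hp
    simp only [Finset.mem_filter_univ] at hp
    simp only [Finset.mem_union, Finset.mem_image, upperSupp, Finset.mem_filter_univ]
    rcases le_total i j with h | h
    · exact Or.inl ⟨⟨(i, j), h⟩, hp, rfl⟩
    · exact Or.inr ⟨⟨(j, i), h⟩, by simpa [vech, hM.apply i j] using hp, rfl⟩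
  calc _ ≤ _ := Finset.card_le_card hsub
    _ ≤ _ := Finset.card_union_le _ _
    _ ≤ _ := add_le_add Finset.card_image_le Finset.card_image_le
    _ = _ := by ring

/-- Equal supports confine the difference to the support of `M`, at most twice the upper one; the
factor `√2` is rounded up to `2`. -/
theorem frobeniusNorm_sub_le {M M' : Matrix (Fin d) (Fin d) ℝ} (hM : M.IsSymm)
    (hsupp : supp M' = supp M) {b : ℝ} (hb : ∀ i j, |M' i j - M i j| ≤ b) (hb0 : 0 ≤ b) :
    frobeniusNorm (M' - M) ≤ 2 * b * √((upperSupp M).card) := by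
  rw [frobeniusNorm_eq_sqrt, Real.sqrt_le_left (by positivity), mul_pow,
    Real.sq_sqrt (Nat.cast_nonneg _)]
  have hz : ∀ p : Fin d × Fin d, M p.1 p.2 = 0 → (M' - M) p.1 p.2 ^ 2 = 0 := by
    intro p hp
    have : p ∉ supp M' := by rw [hsupp]; simpa [supp] using hp
    have : M' p.1 p.2 = 0 := by simpa [supp] using this
    simp [hp, this]
  calc ∑ p : Fin d × Fin d, (M' - M) p.1 p.2 ^ 2
      = ∑ p ∈ Finset.univ.filter (fun p : Fin d × Fin d => M p.1 p.2 ≠ 0),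
          (M' - M) p.1 p.2 ^ 2 := by
        rw [Finset.sum_filter_of_ne]
        exact fun p _ h hp => h (hz p hp)
    _ ≤ ∑ p ∈ Finset.univ.filter (fun p : Fin d × Fin d => M p.1 p.2 ≠ 0), b ^ 2 :=
        Finset.sum_le_sum fun p _ => sq_le_sq' (by
          have := (abs_le.1 (hb p.1 p.2)).1; simpa using this) (by
          have := (abs_le.1 (hb p.1 p.2)).2; simpa using this)
    _ ≤ (2 * (upperSupp M).card : ℕ) * b ^ 2 := by
        rw [Finset.sum_const, nsmul_eq_mul]
        gcongr
        exact card_filter_ne_zero_le hM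
    _ ≤ _ := by
        push_cast
        nlinarith [mul_nonneg (Nat.cast_nonneg (α := ℝ) (upperSupp M).card) (sq_nonneg b)]

/-- Guarantees for the estimates when the proxies are within `lam` of the truth and `lam` is
small compared with the gaps. -/
theorem isEstimate_and_recovery {T : ℕ} {γ θmin Δmin : ℝ} {lam : Fin (T + 1) → ℝ}
    {B Θ : Fin (T + 1) → Matrix (Fin d) (Fin d) ℝ} (hγ0 : 0 < γ) (hγ1 : γ < 1)
    (hΘ : ∀ t, (Θ t).IsSymm) (hlam : ∀ t, 0 ≤ lam t) (hB : ∀ t i j, |B t i j - Θ t i j| ≤ lam t)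
    (hgap : ∀ t, EntryGap θmin (Θ t))
    (hgapd : ∀ t : Fin T, EntryGap Δmin (Θ t.succ - Θ t.castSucc))
    (hθmin : ∀ t, 2 * lam t < θmin) (hΔmin : ∀ t, 4 * lam t < Δmin) :
    IsEstimate γ lam B Θ ∧ ∀ Θhat, IsEstimate γ lam B Θhat →
      (∀ t, supp (Θhat t) = supp (Θ t)) ∧
      (∀ t : Fin T, supp (Θhat t.succ - Θhat t.castSucc) = supp (Θ t.succ - Θ t.castSucc)) ∧
      ∀ t i j, |Θhat t i j - Θ t i j| ≤ 2 * lam t := by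
  have hfeas : IsFeasible lam (fun t => vech (B t)) fun t => vech (Θ t) := by
    intro t
    rw [pi_norm_le_iff_of_nonneg (hlam t)]
    intro k
    rw [Pi.sub_apply, Real.norm_eq_abs, abs_sub_comm]
    exact hB t _ _
  have hclose : ∀ θ', IsFeasible lam (fun t => vech (B t)) θ' → ∀ t k,
      |θ' t k - vech (Θ t) k| ≤ 2 * lam t := by
    intro θ' h t k
    have h1 : |θ' t k - vech (B t) k| ≤ lam t :=
      (norm_le_pi_norm (θ' t - vech (B t)) k).trans (h t)
    have h2 : |vech (B t) k - vech (Θ t) k| ≤ lam t := hB t _ _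
    linarith [abs_sub_le (θ' t k) (vech (B t) k) (vech (Θ t) k)]
  obtain ⟨hopt, hall⟩ := isOptimal_and_support_of_minimal (γ := γ) hγ0 hγ1 hfeas
    (by
      intro θ' h t k hk h0
      have h1 := hclose θ' h t k
      rw [h0, zero_sub, abs_neg] at h1
      have h2 : θmin ≤ |vech (Θ t) k| := hgap t _ _ hk
      linarith [hθmin t])
    (by
      -- Equal values at consecutive times would bound the true increment by `2 * lam` at one time
      -- plus `2 * lam` at the other, less than `Δmin`.
      intro θ' h t k hk h0
      have h1 := hclose θ' h t.succ k
      have h2 := hclose θ' h t.castSucc k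
      have h3 : Δmin ≤ |vech (Θ t.succ) k - vech (Θ t.castSucc) k| := hgapd t _ _ hk
      rw [Pi.sub_apply, sub_eq_zero] at h0
      rw [h0, abs_sub_comm] at h1
      have h4 := abs_sub_le (vech (Θ t.succ) k) (θ' t.castSucc k) (vech (Θ t.castSucc) k)
      linarith [hΔmin t.succ, hΔmin t.castSucc])
  refine ⟨⟨hΘ, hopt⟩, fun Θhat hhat => ?_⟩
  obtain ⟨hs1, hs2⟩ := hall _ hhat.2
  refine ⟨fun t => supp_eq_of_vech (hhat.1 t) (hΘ t) (hs1 t),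
    fun t => supp_eq_of_vech ((hhat.1 _).sub (hhat.1 _)) ((hΘ _).sub (hΘ _)) (hs2 t),
    fun t i j => ?_⟩
  rw [IsSymm.apply_eq_vech (hhat.1 t), IsSymm.apply_eq_vech (hΘ t)]
  exact hclose _ hhat.2.1 t _

end Estimates

end TimeVaryingMRF

namespace TimeVaryingMRF

/-! ### The high-probability event -/

theorem cast_add_one_le_rpow_zeta {d T : ℕ} (hd : 2 ≤ d) : (T : ℝ) + 1 ≤ (d : ℝ) ^ zeta d T := by
  have hd' : (1 : ℝ) < d := by exact_mod_cast (by omega : 1 < d)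
  calc (T : ℝ) + 1 = (d : ℝ) ^ Real.logb d ((T : ℝ) + 1) :=
        (Real.rpow_logb (by linarith) (by linarith) (by positivity)).symm
    _ ≤ _ := Real.rpow_le_rpow_of_exponent_le hd'.le (le_max_left _ _)

/-- Union bound over `(T + 1) * d²` entries, with `T + 1 ≤ d ^ zeta d T`. The factor `3` makes the
exponent `9/8 * τ log d`, and a rate of at most `1/3` keeps the deviation at most `V`. -/
theorem exists_event_abs_sampleCov_sub_le {Ω : Type*} [MeasurableSpace Ω] {μ : Measure Ω}
    [IsProbabilityMeasure μ] {d T : ℕ} (hd : 2 ≤ d) {τ V : ℝ} (hτ : 0 ≤ τ) (hV : 0 < V)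
    {Θ : Fin (T + 1) → Matrix (Fin d) (Fin d) ℝ} (hΘ : ∀ t, (Θ t).PosDef)
    (hΘV : ∀ t i j, |(Θ t)⁻¹ i j| ≤ V / 4) {N : Fin (T + 1) → ℕ} (hN : ∀ t, 0 < N t)
    (hrate : ∀ t, rate τ d (N t) ≤ 1 / 3)
    {X : ∀ t, Fin (N t) → Ω → EuclideanSpace ℝ (Fin d)} (hX : IsGMRFSample μ Θ N X) :
    ∃ E : Set Ω, MeasurableSet E ∧ 1 - 4 * (d : ℝ) ^ (-τ + zeta d T + 2) ≤ μ.real E ∧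
      ∀ ω ∈ E, ∀ t i j,
        |sampleCov (fun k => X t k ω) i j - (Θ t)⁻¹ i j| ≤ 3 * V * rate τ d (N t) := by
  have hd0 : (0 : ℝ) < d := by exact_mod_cast (by omega : 0 < d)
  have hlog : 0 ≤ Real.log d := Real.log_natCast_nonneg d
  set bad : Fin (T + 1) × Fin d × Fin d → Set Ω := fun p =>
    {ω | 3 * V * rate τ d (N p.1) ≤
      |sampleCov (fun k => X p.1 k ω) p.2.1 p.2.2 - (Θ p.1)⁻¹ p.2.1 p.2.2|} with hbad
  have hle : ∀ p, μ.real (bad p) ≤ 4 * (d : ℝ) ^ (-τ) := by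
    rintro ⟨t, i, j⟩
    have hr0 : 0 ≤ rate τ d (N t) := Real.sqrt_nonneg _
    have hNt : (0 : ℝ) < N t := by exact_mod_cast hN t
    refine (measureReal_abs_sampleCov_sub_ge_le (hN t) (hΘ t).inv.posSemidef (hX t).1 (hX t).2 hV
      (hΘV t) (by positivity) (by nlinarith [hrate t]) i j).trans ?_
    rw [Real.rpow_def_of_pos hd0]
    gcongr
    have hsq : rate τ d (N t) ^ 2 = τ * Real.log d / N t := Real.sq_sqrt (by positivity)
    have h1 : (N t : ℝ) * (3 * V * rate τ d (N t)) ^ 2 / (8 * V ^ 2) = 9 / 8 * (τ * Real.log d) := by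
      rw [mul_pow, hsq]; field_simp; ring
    rw [h1]
    nlinarith [mul_nonneg hτ hlog]
  have hsum : μ.real (⋃ p, bad p) ≤ 4 * (d : ℝ) ^ (-τ + zeta d T + 2) := by
    calc μ.real (⋃ p, bad p) ≤ ∑ p, μ.real (bad p) := measureReal_iUnion_fintype_le _
      _ ≤ ∑ _p : Fin (T + 1) × Fin d × Fin d, 4 * (d : ℝ) ^ (-τ) :=
          Finset.sum_le_sum fun p _ => hle p
      _ = 4 * (d : ℝ) ^ (-τ) * ((T : ℝ) + 1) * (d : ℝ) ^ (2 : ℝ) := by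
          simp; ring
      _ ≤ 4 * (d : ℝ) ^ (-τ) * (d : ℝ) ^ zeta d T * (d : ℝ) ^ (2 : ℝ) := by
          gcongr
          exact cast_add_one_le_rpow_zeta hd
      _ = _ := by rw [Real.rpow_add hd0, Real.rpow_add hd0]; ring
  -- The samples are only a.e. measurable, so the bad set is replaced by its measurable hull, of the
  -- same measure.
  refine ⟨(toMeasurable μ (⋃ p, bad p))ᶜ, (measurableSet_toMeasurable _ _).compl, ?_, ?_⟩
  · rw [probReal_compl_eq_one_sub (measurableSet_toMeasurable _ _), measureReal_def,
      measure_toMeasurable, ← measureReal_def]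
    linarith
  · intro ω hω t i j
    by_contra! hcon
    exact hω (subset_toMeasurable _ _ (Set.mem_iUnion.2 ⟨(t, i, j), hcon.le⟩))

/-! ### The sample size -/

/-- With `p = 1 / (1 - q)` the condition on `n` says `√(L / n) ≤ ε / s ^ p`. One half of `ε` uses
`s₀ ≤ s`; the other cancels `s` after taking the power `1 - q`. -/
theorem exists_sampleSize_const {q s₀ η b c : ℝ} (hq1 : q < 1) (hs₀ : 0 < s₀) (hη : 0 < η)
    (hb : 0 < b) (hc : 0 < c) :
    ∃ C : ℝ, 0 < C ∧ ∀ s L n : ℝ, s₀ ≤ s → 0 < L → C * (s ^ (2 / (1 - q)) * L) ≤ n →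
      0 < n ∧ √(L / n) ≤ η ∧ s * (b * √(L / n)) ^ (1 - q) ≤ c := by
  have hq : 0 < 1 - q := by linarith
  set p : ℝ := (1 - q)⁻¹ with hp
  have hp0 : 0 < p := inv_pos.2 hq
  set ε : ℝ := min (η * s₀ ^ p) (c ^ p / b) with hε
  have hε0 : 0 < ε := lt_min (by positivity) (by positivity)
  refine ⟨(ε ^ 2)⁻¹, by positivity, fun s L n hs hL hn => ?_⟩
  have hs0 : 0 < s := hs₀.trans_le hs
  have hsp : 0 < s ^ p := by positivity
  have hpow : s ^ (2 / (1 - q)) = (s ^ p) ^ 2 := by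
    rw [← Real.rpow_natCast, ← Real.rpow_mul hs0.le, hp, div_eq_mul_inv, mul_comm]
    norm_cast
  rw [hpow] at hn
  have hn0 : 0 < n := lt_of_lt_of_le (by positivity) hn
  have hr : √(L / n) ≤ ε / s ^ p := by
    rw [Real.sqrt_le_left (by positivity), div_pow, div_le_div_iff₀ hn0 (by positivity)]
    rw [inv_mul_le_iff₀ (by positivity)] at hn
    linarith
  refine ⟨hn0, hr.trans ?_, ?_⟩
  · rw [div_le_iff₀ hsp]
    exact (min_le_left _ _).trans (by gcongr)
  · have h1 : b * √(L / n) ≤ (c / s) ^ p := by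
      rw [Real.div_rpow hc.le hs0.le]
      calc b * √(L / n) ≤ b * (ε / s ^ p) := by gcongr
        _ ≤ b * (c ^ p / b / s ^ p) := by gcongr; exact min_le_right _ _
        _ = _ := by field_simp
    calc s * (b * √(L / n)) ^ (1 - q) ≤ s * ((c / s) ^ p) ^ (1 - q) := by gcongr
      _ = c := by
        rw [← Real.rpow_mul (by positivity), hp, inv_mul_cancel₀ hq.ne', Real.rpow_one]
        field_simp

end TimeVaryingMRF

/-! ### Choice of the constants and conclusion -/

open TimeVaryingMRF in
theorem theorem3 (κ₁ κ₂ κ₃ : ℝ) (hκ₂ : 0 < κ₂) :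
    -- constants in `ν_t ≍ √(τ log d / N_t)` and `λ_t ≍ √(τ log d / N_t)`
    ∃ aν : ℝ, 0 < aν ∧ ∀ bν : ℝ, aν ≤ bν →
    ∃ aL : ℝ, 0 < aL ∧ ∀ bL : ℝ, aL ≤ bL →
    -- constant in the estimation errors
    ∃ K : ℝ, 0 < K ∧
    ∀ (q : ℝ), 0 ≤ q → q < 1 →
    ∀ (θmin Δmin : ℝ), 0 < θmin → 0 < Δmin →
    -- constant in the sample size
    ∃ C : ℝ, 0 < C ∧
    ∀ (s : ℝ → ℕ → ℝ) (d T : ℕ), 2 ≤ d →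
    ∀ (Θ : Fin (T + 1) → Matrix (Fin d) (Fin d) ℝ),
      (∀ t, (Θ t).PosDef) →
      (∀ t, BoundedNorm κ₁ κ₂ κ₃ (Θ t)) →
      (∀ t, WeaklySparse q (s q d) (Θ t)⁻¹) →
      (∀ t, EntryGap θmin (Θ t)) →
      (∀ t : Fin T, EntryGap Δmin (Θ t.succ - Θ t.castSucc)) →
    ∀ (τ : ℝ), zeta d T + 2 < τ →
    ∀ (N : Fin (T + 1) → ℕ),
      (∀ t, C * (s q d ^ (2 / (1 - q)) * (τ * Real.log d)) ≤ (N t : ℝ)) →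
    ∀ {Ω : Type*} [MeasurableSpace Ω] (μ : Measure Ω) [IsProbabilityMeasure μ]
      (X : ∀ t, Fin (N t) → Ω → EuclideanSpace ℝ (Fin d)),
      IsGMRFSample μ Θ N X →
    ∀ (ν lam : Fin (T + 1) → ℝ),
      (∀ t, aν * rate τ d (N t) ≤ ν t ∧ ν t ≤ bν * rate τ d (N t)) →
      (∀ t, aL * rate τ d (N t) ≤ lam t ∧ lam t ≤ bL * rate τ d (N t)) →
    ∀ (γ : ℝ), 0 < γ → γ < 1 →
    ∃ E : Set Ω, MeasurableSet E ∧
      1 - 4 * (d : ℝ) ^ (-τ + zeta d T + 2) ≤ μ.real E ∧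
      ∀ ω ∈ E,
        -- the approximate backward mapping and the estimates are well defined
        (∀ t, IsUnit (softThreshold (ν t) (sampleCov fun i => X t i ω))) ∧
        (∃ Θhat, IsEstimate γ lam
          (fun t => (softThreshold (ν t) (sampleCov fun i => X t i ω))⁻¹) Θhat) ∧
        ∀ Θhat, IsEstimate γ lam
            (fun t => (softThreshold (ν t) (sampleCov fun i => X t i ω))⁻¹) Θhat →
          (∀ t, supp (Θhat t) = supp (Θ t)) ∧
          (∀ t : Fin T,
            supp (Θhat t.succ - Θhat t.castSucc) = supp (Θ t.succ - Θ t.castSucc)) ∧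
          (∀ t, maxEntryNorm (Θhat t - Θ t) ≤ K * rate τ d (N t)) ∧
          (∀ t, frobeniusNorm (Θhat t - Θ t) ≤
            K * Real.sqrt (τ * ((upperSupp (Θ t)).card : ℝ) * Real.log d / (N t : ℝ))) := by
  set k₁ : ℝ := max κ₁ 1 with hk₁
  have hk₁0 : 0 < k₁ := lt_max_of_lt_right one_pos
  set V : ℝ := 4 * max κ₃ 1 with hV
  have hV0 : 0 < V := mul_pos (by norm_num) (lt_max_of_lt_right one_pos)
  refine ⟨3 * V, by positivity, fun bν hbν => ?_⟩
  have hbν0 : 0 < bν := lt_of_lt_of_le (by positivity) hbν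
  -- The inverse error bound `2 / κ₂ * (δ * k₁)` with `δ = 2 * ν ≤ 2 * bν * rate`.
  refine ⟨4 * bν * k₁ / κ₂, by positivity, fun bL hbL => ?_⟩
  have hbL0 : 0 < bL := lt_of_lt_of_le (by positivity) hbL
  refine ⟨4 * bL, by positivity, fun q hq0 hq1 θmin Δmin hθmin hΔmin => ?_⟩
  -- In `η`, `1/3` serves concentration, `κ₂ / (4 * bν)` gives `ν ≤ κ₂ / 4`, and the rest serve the
  -- gaps. With `c = κ₂ / 4` the row sums stay below `κ₂ / 2`.
  obtain ⟨C, hC, hsize⟩ := exists_sampleSize_const (q := q) (s₀ := min 1 k₁⁻¹)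
    (η := min (min (1 / 3) (κ₂ / (4 * bν))) (min (θmin / (4 * bL)) (Δmin / (8 * bL))))
    (b := 2 * bν) (c := κ₂ / 4) hq1 (lt_min one_pos (inv_pos.2 hk₁0))
    (lt_min (lt_min (by norm_num) (by positivity)) (lt_min (by positivity) (by positivity)))
    (by positivity) (by positivity)
  refine ⟨C, hC, fun s d T hd Θ hΘ hb hsparse hgap hgapd τ hτ N hN Ω _ μ _ X hX ν lam hν hlam γ
    hγ0 hγ1 => ?_⟩
  have hτ0 : 0 < τ := by
    have : 1 ≤ zeta d T := le_max_right _ _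
    linarith
  have hlog : 0 < Real.log d := Real.log_pos (by exact_mod_cast (by omega : 1 < d))
  have hb' : ∀ t, BoundedNorm k₁ κ₂ κ₃ (Θ t) := fun t =>
    ⟨(hb t).1.trans (le_max_left _ _), (hb t).2⟩
  have hs₀ : min 1 k₁⁻¹ ≤ s q d := min_one_inv_le_of_weaklySparse ⟨0, by omega⟩ hk₁0 (hΘ 0)
    (hb' 0).1 hq0 hq1 (hsparse 0)
  have hsz := fun t => hsize (s q d) (τ * Real.log d) (N t) hs₀ (by positivity) (hN t)
  have hNpos : ∀ t, 0 < N t := fun t => by exact_mod_cast (hsz t).1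
  have hr0 : ∀ t, 0 ≤ rate τ d (N t) := fun t => Real.sqrt_nonneg _
  have hr : ∀ t, rate τ d (N t) ≤ 1 / 3 ∧ bν * rate τ d (N t) ≤ κ₂ / 4 ∧
      4 * bL * rate τ d (N t) ≤ θmin ∧ 8 * bL * rate τ d (N t) ≤ Δmin := by
    intro t
    have h := (hsz t).2.1
    rw [le_min_iff, le_min_iff, le_min_iff, le_div_iff₀ (mul_pos four_pos hbν0),
      le_div_iff₀ (mul_pos four_pos hbL0), le_div_iff₀ (mul_pos (by norm_num) hbL0)] at h
    obtain ⟨⟨h1, h2⟩, h3, h4⟩ := h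
    unfold rate
    exact ⟨h1, by linarith, by linarith, by linarith⟩
  have hrs : ∀ t, s q d * (2 * bν * rate τ d (N t)) ^ (1 - q) ≤ κ₂ / 4 := fun t => (hsz t).2.2
  have hs0 : 0 ≤ s q d := le_trans (by positivity) hs₀
  obtain ⟨E, hE, hμE, hdev⟩ := exists_event_abs_sampleCov_sub_le (μ := μ) hd hτ0.le hV0 hΘ
    (fun t i j => (abs_apply_le_maxEntryNorm _ i j).trans
      ((hb t).2.2.trans ((le_max_left _ 1).trans_eq (by rw [hV]; ring))))
    hNpos (fun t => (hr t).1) hX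
  refine ⟨E, hE, hμE, fun ω hω => ?_⟩
  have hdev' : ∀ t i j, |sampleCov (fun k => X t k ω) i j - (Θ t)⁻¹ i j| ≤ ν t :=
    fun t i j => (hdev ω hω t i j).trans (hν t).1
  have hν0 : ∀ t, 0 ≤ ν t := fun t =>
    (mul_nonneg (by positivity) (hr0 t)).trans (hν t).1
  have hinv := fun t => isUnit_and_abs_inv_sub_le hκ₂ (hΘ t) (hb' t)
    (fun i => (sum_abs_softThreshold_sub_le hq0 hq1 (hsparse t) (hdev' t) i).trans (by
      have h1 : s q d * (2 * ν t) ^ (1 - q) ≤ s q d * (2 * bν * rate τ d (N t)) ^ (1 - q) := by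
        refine mul_le_mul_of_nonneg_left (Real.rpow_le_rpow ?_ ?_ (by linarith)) hs0
        · linarith [hν0 t]
        · linarith [(hν t).2]
      linarith [hrs t, (hν t).2, (hr t).2.1]))
    (abs_softThreshold_sub_le (hdev' t))
  have hB : ∀ t i j, |(softThreshold (ν t) (sampleCov fun k => X t k ω))⁻¹ i j - Θ t i j|
      ≤ lam t := fun t i j => by
    refine ((hinv t).2 i j).trans (le_trans ?_ (hlam t).1)
    calc 2 / κ₂ * (2 * ν t * k₁) ≤ 2 / κ₂ * (2 * (bν * rate τ d (N t)) * k₁) := by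
          gcongr; exact (hν t).2
      _ = _ := by ring
  have hlam0 : ∀ t, 0 ≤ lam t := fun t => (mul_nonneg (by positivity) (hr0 t)).trans (hlam t).1
  -- Positivity of the rate makes the gap inequalities strict: `η` leaves a factor two to spare.
  have hrpos : ∀ t, 0 < rate τ d (N t) := fun t => by
    have := (hsz t).1
    exact Real.sqrt_pos.2 (by positivity)
  have hbr : ∀ t, 0 < bL * rate τ d (N t) := fun t => mul_pos hbL0 (hrpos t)
  have hsymm : ∀ t, (Θ t).IsSymm := fun t => by
    simpa [Matrix.IsHermitian, Matrix.IsSymm] using (hΘ t).1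
  obtain ⟨hest, hall⟩ := isEstimate_and_recovery (γ := γ) hγ0 hγ1 hsymm
    hlam0 hB hgap hgapd
    (fun t => by linarith [(hr t).2.2.1, (hlam t).2, hbr t])
    (fun t => by linarith [(hr t).2.2.2, (hlam t).2, hbr t])
  refine ⟨fun t => (hinv t).1, ⟨Θ, hest⟩, fun Θhat hhat => ?_⟩
  obtain ⟨hs1, hs2, herr⟩ := hall Θhat hhat
  refine ⟨hs1, hs2, fun t => ?_, fun t => ?_⟩
  · rw [maxEntryNorm_le_iff (mul_nonneg (by positivity) (hr0 t))]
    intro i j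
    exact (herr t i j).trans (by linarith [(hlam t).2, hbr t])
  · refine (frobeniusNorm_sub_le (hsymm t) (hs1 t) (herr t) (by linarith [hlam0 t])).trans ?_
    calc 2 * (2 * lam t) * √((upperSupp (Θ t)).card)
        ≤ 2 * (2 * (bL * rate τ d (N t))) * √((upperSupp (Θ t)).card) := by
          gcongr; exact (hlam t).2
      _ = 4 * bL * (rate τ d (N t) * √((upperSupp (Θ t)).card)) := by ring
      _ = _ := by
          rw [rate, ← Real.sqrt_mul (by positivity)]
          congr 2
          ring
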